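/- Let $V$ be a finite set and let $\mathcal{H}$ be a hypergraph on $V$, i.e. a set of non-empty subsets of $V$, called edges. A set $W\subseteq V$ is independent if it contains no edge, and $\mathcal{I}(\mathcal{H})$ is the abstract simplicial complex of all independent sets (including $\emptyset$). For an abstract simplicial complex $K$, let $\tilde H_i(K)$ denote the reduced simplicial homology of $K$ with coefficients in $\mathbb{Z}/2$ (so $\tilde H_{-1}(\{\emptyset\})=\mathbb{Z}/2$), and let $\eta(K)$ be the largest integer $k$ such that $\tilde H_i(K)=0$ for all $-1\le i\le k-2$, with $\eta(K)=\infty$ if there is no largest such $k$. A set $W\subseteq V$ dominates a vertex $v$ if there is $W'\subseteq W\setminus\{v\}$ such that $W'\cup\{v\}$ is an edge, and $W$ dominates $A\subseteq V$ if it dominates every vertex of $A$. Let $\gamma(\mathcal{H};A)=\min\{|W| : W\subseteq V \text{ dominates } A\}$, and put $\tilde\gamma(\mathcal{H})=\gamma(\mathcal{H};V)$. A set $A\subseteq V$ is strongly independent if it is independent and every edge contains at most one vertex of $A$; let $\gamma_{si}(\mathcal{H})=\max\{\gamma(\mathcal{H};A) : A \text{ strongly independent}\}$. Let $\gamma_E(\mathcal{H})=\min\{|\mathcal{F}|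 : \mathcal{F}\subseteq\mathcal{H},\ \bigcup_{F\in\mathcal{F}}F \text{ dominates } V\}$. A minimum over the empty set is $\infty$, and $\lceil\infty/2\rceil=\infty$. Then for every hypergraph $\mathcal{H}$ on a finite vertex set, $$\eta(\mathcal{I}(\mathcal{H}))\ \ge\ \max\left\{\left\lceil\frac{\tilde\gamma(\mathcal{H})}{2}\right\rceil,\ \gamma_{si}(\mathcal{H}),\ \gamma_E(\mathcal{H})\right\}.$$ -/

import Mathlib

/-- A hypergraph on the finite vertex set `V`: a set of non-empty subsets of `V`. -/
structure FinHypergraph (V : Type*) where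
  edges : Finset (Finset V)
  nonempty_of_mem : ∀ e ∈ edges, e.Nonempty

/-- An abstract simplicial complex on `V`: a family of finite subsets of `V` that is closed under
taking subsets. The empty set is a face of every complex except the void one. -/
abbrev FaceComplex (V : Type*) := LowerSet (Finset V)

namespace FaceComplex

variable {V : Type*}

/-- The simplicial boundary with `ℤ/2` coefficients, on the free module over all finite subsets of
`V`: a set `σ` goes to the sum of the sets `σ \ {v}`, `v ∈ σ`. In particular a one-point set goes to
the empty set, which makes the resulting homology the reduced one. -/
noncomputable def boundary (V : Type*) [DecidableEq V] :
    (Finset V →₀ ZMod 2) →ₗ[ZMod 2] (Finset V →₀ ZMod 2) :=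
  Finsupp.linearCombination (ZMod 2) fun σ : Finset V =>
    ∑ v ∈ σ, Finsupp.single (σ.erase v) (1 : ZMod 2)

/-- The `i`-chains of `K`: combinations of the faces of dimension `i`, i.e. of size `i + 1`. -/
def chains (K : FaceComplex V) (i : ℤ) : Submodule (ZMod 2) (Finset V →₀ ZMod 2) :=
  Finsupp.supported (ZMod 2) (ZMod 2) {σ : Finset V | σ ∈ K ∧ (σ.card : ℤ) = i + 1}

variable [DecidableEq V]

/-- The (reduced) `i`-cycles of `K`. -/
noncomputable def cycles (K : FaceComplex V) (i : ℤ) : Submodule (ZMod 2) (Finset V →₀ ZMod 2) :=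
  chains K i ⊓ LinearMap.ker (boundary V)

/-- The `i`-boundaries of `K`. -/
noncomputable def boundaries (K : FaceComplex V) (i : ℤ) :
    Submodule (ZMod 2) (Finset V →₀ ZMod 2) :=
  (chains K (i + 1)).map (boundary V)

/-- The reduced homology `H̃ᵢ(K)` with `ℤ/2` coefficients: `i`-cycles modulo `i`-boundaries. -/
abbrev ReducedHomology (K : FaceComplex V) (i : ℤ) : Type _ :=
  cycles K i ⧸
    (Submodule.comap (cycles K i).subtype (boundaries K i) : Submodule (ZMod 2) (cycles K i))

/-- `K` is (homologically) `k`-connected: `H̃ᵢ(K) = 0` for all `-1 ≤ i ≤ k`. -/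
def IsHomConnected (K : FaceComplex V) (k : ℤ) : Prop :=
  ∀ i : ℤ, -1 ≤ i → i ≤ k → Subsingleton (ReducedHomology K i)

/-- `η(K)`: the largest `k` such that `K` is `(k - 2)`-connected, and `∞` if there is no largest
one. Every complex is `(k - 2)`-connected for all `k ≤ 0`, so only natural numbers `k` matter. -/
noncomputable def eta (K : FaceComplex V) : ℕ∞ :=
  ⨆ (k : ℕ) (_ : IsHomConnected K ((k : ℤ) - 2)), (k : ℕ∞)

end FaceComplex

namespace FinHypergraph

variable {V : Type*} (H : FinHypergraph V)

/-- `W` is independent: it contains no edge. -/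
def Independent (W : Finset V) : Prop :=
  ∀ e ∈ H.edges, ¬ e ⊆ W

/-- The independence complex: its faces are the independent sets. -/
def independenceComplex : FaceComplex V where
  carrier := {W | H.Independent W}
  lower' := fun _ _ hba ha e he heb => ha e he (heb.trans hba)

variable [DecidableEq V]

/-- `W` (strongly totally) dominates the vertex `v`: some `W' ⊆ W \ {v}` has `W' ∪ {v}` an edge. -/
def DominatesVertex (W : Finset V) (v : V) : Prop :=
  ∃ W' : Finset V, W' ⊆ W.erase v ∧ insert v W' ∈ H.edges

/-- `W` (strongly totally) dominates every vertex of `A`. -/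
def Dominates (W A : Finset V) : Prop :=
  ∀ v ∈ A, H.DominatesVertex W v

/-- The strong total domination number `γ(H; A)` of `A`, with value `∞` if no set dominates `A`. -/
noncomputable def domNumber (A : Finset V) : ℕ∞ :=
  ⨅ (W : Finset V) (_ : H.Dominates W A), (W.card : ℕ∞)

/-- `A` is strongly independent: it is independent and meets each edge in at most one vertex. -/
def StronglyIndependent (A : Finset V) : Prop :=
  H.Independent A ∧ ∀ e ∈ H.edges, (e ∩ A).card ≤ 1

/-- The strong independence domination number `γ_si(H)`. An isolated vertex `v` makes it `∞`, as
`{v}` is then strongly independent and not dominated by any set. -/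
noncomputable def siDomNumber : ℕ∞ :=
  ⨆ (A : Finset V) (_ : H.StronglyIndependent A), H.domNumber A

/-- The strong total domination number `γ̃(H)`: that of the whole vertex set. -/
noncomputable def totalDomNumber [Fintype V] : ℕ∞ :=
  H.domNumber Finset.univ

/-- The edgewise-domination number `γ_E(H)`: the least number of edges whose union dominates the
whole vertex set, with value `∞` if there are no such edges. -/
noncomputable def edgeDomNumber [Fintype V] : ℕ∞ :=
  ⨅ (F : Finset (Finset V)) (_ : F ⊆ H.edges ∧ H.Dominates (F.biUnion id) Finset.univ),
    (F.card : ℕ∞)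

end FinHypergraph

/-- `⌈n / 2⌉`, with `⌈∞ / 2⌉ = ∞`. -/
noncomputable def ceilHalf (n : ℕ∞) : ℕ∞ :=
  ENat.recTopCoe (C := fun _ => ℕ∞) ⊤ (fun m : ℕ => ((⌈(m : ℚ) / 2⌉₊ : ℕ) : ℕ∞)) n

/-! Everything rests on one inequality: for an edge `e`, `η(I(H)) ≥ min(η(I(H - e)), η(I(H / e)) +
|e| - 1)`. For inclusion-minimal `e`, `I(H)` consists of the faces of `I(H - e)` not containing `e`,
and `I(H / e)` is the link of `e` in `I(H - e)`, so a long exact sequence argument applies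
(`cycles_le_boundaries_of_link`, `isHomConnected_of_delete_of_contract`).

By induction on the number of edges with at least two vertices (`isHomConnected_of_recursion`), a
lower bound on `η` follows once it survives deletion and drops by at most `|e| - 1` under
contraction. An isolated vertex makes the complex a cone, and the bound `0` is trivial. Deleting an
edge only makes domination harder; each of the three parameters then needs only a way to turn a
dominating family of `H / e` into one of `H`. -/

namespace FaceComplex

variable {V : Type*}

/-! ### Chains over `ℤ/2` and the boundary operator. -/

theorem add_self_eq_zero_of_zmod_two {M : Type*} [AddCommGroup M] [Module (ZMod 2) M] (x : M) :
    x + x = 0 := by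
  rw [← two_smul (ZMod 2) x, show (2 : ZMod 2) = 0 from rfl, zero_smul]

/-- A linear map sends chains supported on `S` into `N` as soon as it does so for the faces. -/
theorem apply_mem_of_supported {M : Type*} [AddCommGroup M] [Module (ZMod 2) M]
    {S : Set (Finset V)} (f : (Finset V →₀ ZMod 2) →ₗ[ZMod 2] M) (N : Submodule (ZMod 2) M)
    (h : ∀ σ ∈ S, f (Finsupp.single σ 1) ∈ N) {c : Finset V →₀ ZMod 2}
    (hc : c ∈ Finsupp.supported (ZMod 2) (ZMod 2) S) : f c ∈ N := by
  rw [Finsupp.supported_eq_span_single] at hc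
  refine (Submodule.span_le (p := N.comap f)).2 ?_ hc
  rintro _ ⟨σ, hσ, rfl⟩
  exact h σ hσ

theorem eq_of_supported {M : Type*} [AddCommGroup M] [Module (ZMod 2) M]
    {S : Set (Finset V)} (f g : (Finset V →₀ ZMod 2) →ₗ[ZMod 2] M)
    (h : ∀ σ ∈ S, f (Finsupp.single σ 1) = g (Finsupp.single σ 1)) {c : Finset V →₀ ZMod 2}
    (hc : c ∈ Finsupp.supported (ZMod 2) (ZMod 2) S) : f c = g c := by
  have := apply_mem_of_supported (f - g) ⊥ (fun σ hσ => by simp [h σ hσ]) hc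
  simpa [sub_eq_zero] using this

theorem single_mem_supported {S : Set (Finset V)} {σ : Finset V} (h : σ ∈ S) :
    Finsupp.single σ (1 : ZMod 2) ∈ Finsupp.supported (ZMod 2) (ZMod 2) S :=
  Finsupp.single_mem_supported _ _ h

theorem chains_mono {K L : FaceComplex V} (h : K ≤ L) (i : ℤ) : chains K i ≤ chains L i :=
  Finsupp.supported_mono fun _ hσ => ⟨h hσ.1, hσ.2⟩

theorem exists_add_eq_of_superset (e : Finset V) {S : Set (Finset V)} {c : Finset V →₀ ZMod 2}
    (hc : c ∈ Finsupp.supported (ZMod 2) (ZMod 2) S) :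
    ∃ c₀ ∈ Finsupp.supported (ZMod 2) (ZMod 2) (S ∩ {σ : Finset V | ¬ e ⊆ σ}),
      ∃ c₁ ∈ Finsupp.supported (ZMod 2) (ZMod 2) (S ∩ {σ : Finset V | e ⊆ σ}), c₀ + c₁ = c := by
  have hS : S = (S ∩ {σ : Finset V | ¬ e ⊆ σ}) ∪ (S ∩ {σ : Finset V | e ⊆ σ}) := by
    ext σ
    by_cases h : e ⊆ σ <;> simp [h]
  rw [hS, Finsupp.supported_union] at hc
  exact Submodule.mem_sup.1 hc

variable [DecidableEq V]

theorem boundary_single (σ : Finset V) :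
    boundary V (Finsupp.single σ 1) = ∑ v ∈ σ, Finsupp.single (σ.erase v) (1 : ZMod 2) := by
  simp [boundary]

theorem boundary_comp_boundary : boundary V ∘ₗ boundary V = 0 := by
  refine Finsupp.lhom_ext' fun σ => LinearMap.ext_ring ?_
  simp only [LinearMap.comp_apply, Finsupp.lsingle_apply, boundary_single, map_sum,
    LinearMap.zero_apply]
  rw [Finset.sum_sigma']
  refine Finset.sum_involution (fun x _ => ⟨x.2, x.1⟩) ?_ ?_ ?_ ?_
  · intro x _
    rw [Finset.erase_right_comm]
    exact add_self_eq_zero_of_zmod_two _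
  · rintro ⟨u, v⟩ h _ heq
    simp only [Finset.mem_sigma, Finset.mem_erase] at h
    simp only [Sigma.mk.injEq] at heq
    exact h.2.1 heq.1
  · rintro ⟨u, v⟩ h
    simp only [Finset.mem_sigma, Finset.mem_erase] at h ⊢
    exact ⟨h.2.2, h.2.1.symm, h.1⟩
  · rintro ⟨u, v⟩ _
    rfl

theorem boundary_boundary (c : Finset V →₀ ZMod 2) : boundary V (boundary V c) = 0 := by
  rw [← LinearMap.comp_apply, boundary_comp_boundary, LinearMap.zero_apply]

theorem subsingleton_reducedHomology_iff (K : FaceComplex V) (i : ℤ) :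
    Subsingleton (ReducedHomology K i) ↔ cycles K i ≤ boundaries K i := by
  rw [Submodule.Quotient.subsingleton_iff, Submodule.comap_subtype_eq_top]

theorem isHomConnected_iff (K : FaceComplex V) (k : ℤ) :
    IsHomConnected K k ↔ ∀ i : ℤ, -1 ≤ i → i ≤ k → cycles K i ≤ boundaries K i := by
  simp only [IsHomConnected, subsingleton_reducedHomology_iff]

/-! ### Cones are acyclic. -/

/-- The cone operator with apex `v`. -/
noncomputable def cone (v : V) : (Finset V →₀ ZMod 2) →ₗ[ZMod 2] (Finset V →₀ ZMod 2) :=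
  Finsupp.linearCombination (ZMod 2) fun σ : Finset V =>
    if v ∈ σ then 0 else Finsupp.single (insert v σ) (1 : ZMod 2)

theorem cone_single (v : V) (σ : Finset V) :
    cone v (Finsupp.single σ 1) =
      if v ∈ σ then 0 else Finsupp.single (insert v σ) (1 : ZMod 2) := by
  simp [cone]

/-- A chain homotopy between the identity and zero: on a face without `v` all terms but the face
itself cancel in pairs; on a face with `v` only the term erasing `v` survives coning. -/
theorem boundary_cone_add (v : V) (c : Finset V →₀ ZMod 2) :
    boundary V (cone v c) + cone v (boundary V c) = c := by
  refine LinearMap.congr_fun (f := boundary V ∘ₗ cone v + cone v ∘ₗ boundary V)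
    (g := LinearMap.id) ?_ c
  refine Finsupp.lhom_ext' fun σ => LinearMap.ext_ring ?_
  simp only [LinearMap.comp_apply, LinearMap.add_apply, Finsupp.lsingle_apply, boundary_single,
    map_sum, cone_single, LinearMap.id_apply]
  by_cases hv : v ∈ σ
  · rw [if_pos hv, map_zero, zero_add, Finset.sum_eq_single_of_mem v hv]
    · simp [Finset.insert_erase hv]
    · intro u _ huv
      rw [if_pos (Finset.mem_erase.2 ⟨huv.symm, hv⟩)]
  · rw [if_neg hv, boundary_single, Finset.sum_insert hv, Finset.erase_insert hv, add_assoc,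
      ← Finset.sum_add_distrib, Finset.sum_eq_zero, add_zero]
    intro u hu
    have huv : u ≠ v := fun h => hv (h ▸ hu)
    rw [if_neg (fun h => hv (Finset.mem_of_mem_erase h)),
      Finset.erase_insert_of_ne huv.symm]
    exact add_self_eq_zero_of_zmod_two _

theorem isHomConnected_of_cone {K : FaceComplex V} {v : V} (h : ∀ σ ∈ K, insert v σ ∈ K) (k : ℤ) :
    IsHomConnected K k := by
  rw [isHomConnected_iff]
  rintro i - - z ⟨hz, hz0⟩
  refine ⟨cone v z, ?_, ?_⟩
  · refine apply_mem_of_supported _ _ ?_ hz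
    rintro σ ⟨hσ, hcard⟩
    rw [cone_single]
    split_ifs with hv
    · exact Submodule.zero_mem _
    · refine single_mem_supported ⟨h σ hσ, ?_⟩
      rw [Finset.card_insert_of_notMem hv]
      push_cast
      linarith
  · have := boundary_cone_add v z
    rwa [LinearMap.mem_ker.1 hz0, map_zero, add_zero] at this

/-! ### Joins with a simplex, and the exact sequence of a link. -/

/-- Joining with the full simplex on `e`. -/
noncomputable def joinFace (e : Finset V) :
    (Finset V →₀ ZMod 2) →ₗ[ZMod 2] (Finset V →₀ ZMod 2) :=
  Finsupp.lmapDomain (ZMod 2) (ZMod 2) (· ∪ e)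

/-- Removing the vertices of `e` from every face. -/
noncomputable def removeFace (e : Finset V) :
    (Finset V →₀ ZMod 2) →ₗ[ZMod 2] (Finset V →₀ ZMod 2) :=
  Finsupp.lmapDomain (ZMod 2) (ZMod 2) (· \ e)

/-- Joining with the boundary of the simplex on `e`. -/
noncomputable def joinBoundary (e : Finset V) :
    (Finset V →₀ ZMod 2) →ₗ[ZMod 2] (Finset V →₀ ZMod 2) :=
  Finsupp.linearCombination (ZMod 2) fun τ : Finset V =>
    ∑ u ∈ e, Finsupp.single (τ ∪ e.erase u) (1 : ZMod 2)

theorem joinFace_single (e τ : Finset V) :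
    joinFace e (Finsupp.single τ 1) = Finsupp.single (τ ∪ e) 1 := by
  simp [joinFace]

theorem removeFace_single (e τ : Finset V) :
    removeFace e (Finsupp.single τ 1) = Finsupp.single (τ \ e) 1 := by
  simp [removeFace]

theorem joinBoundary_single (e τ : Finset V) :
    joinBoundary e (Finsupp.single τ 1) =
      ∑ u ∈ e, Finsupp.single (τ ∪ e.erase u) (1 : ZMod 2) := by
  simp [joinBoundary]

/-- The Leibniz rule for joins; disjointness splits the vertices of `τ ∪ e` into those of `τ` and
those of `e`. -/
theorem boundary_joinFace {e : Finset V} {d : Finset V →₀ ZMod 2}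
    (hd : d ∈ Finsupp.supported (ZMod 2) (ZMod 2) {τ : Finset V | Disjoint τ e}) :
    boundary V (joinFace e d) = joinFace e (boundary V d) + joinBoundary e d := by
  refine eq_of_supported (boundary V ∘ₗ joinFace e)
    (joinFace e ∘ₗ boundary V + joinBoundary e) ?_ hd
  intro τ hτ
  simp only [LinearMap.comp_apply, LinearMap.add_apply, joinFace_single, boundary_single, map_sum,
    joinBoundary_single]
  rw [Finset.sum_union hτ]
  congr 1
  · refine Finset.sum_congr rfl fun v hv => ?_
    rw [Finset.erase_union_distrib, Finset.erase_eq_of_notMem (Finset.disjoint_left.1 hτ hv)]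
  · refine Finset.sum_congr rfl fun v hv => ?_
    rw [Finset.erase_union_distrib, Finset.erase_eq_of_notMem (Finset.disjoint_right.1 hτ hv)]

theorem removeFace_joinFace {e : Finset V} {d : Finset V →₀ ZMod 2}
    (hd : d ∈ Finsupp.supported (ZMod 2) (ZMod 2) {τ : Finset V | Disjoint τ e}) :
    removeFace e (joinFace e d) = d := by
  refine eq_of_supported (removeFace e ∘ₗ joinFace e) LinearMap.id ?_ hd
  intro τ hτ
  simp only [LinearMap.comp_apply, joinFace_single, removeFace_single, LinearMap.id_apply]
  rw [Finset.union_sdiff_right, Finset.sdiff_eq_self_of_disjoint hτ]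

theorem joinFace_removeFace {e : Finset V} {c : Finset V →₀ ZMod 2}
    (hc : c ∈ Finsupp.supported (ZMod 2) (ZMod 2) {σ : Finset V | e ⊆ σ}) :
    joinFace e (removeFace e c) = c := by
  refine eq_of_supported (joinFace e ∘ₗ removeFace e) LinearMap.id ?_ hc
  intro τ hτ
  simp only [LinearMap.comp_apply, joinFace_single, removeFace_single, LinearMap.id_apply]
  rw [Finset.sdiff_union_of_subset hτ]

theorem boundary_mem_supported_not_superset {e : Finset V} {c : Finset V →₀ ZMod 2}
    (hc : c ∈ Finsupp.supported (ZMod 2) (ZMod 2) {σ : Finset V | ¬ e ⊆ σ}) :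
    boundary V c ∈ Finsupp.supported (ZMod 2) (ZMod 2) {σ : Finset V | ¬ e ⊆ σ} := by
  refine apply_mem_of_supported _ _ ?_ hc
  intro σ hσ
  rw [boundary_single]
  exact Submodule.sum_mem _ fun v _ => single_mem_supported
    fun h => hσ (h.trans (Finset.erase_subset _ _))

theorem joinBoundary_mem_supported_not_superset {e : Finset V} {d : Finset V →₀ ZMod 2}
    (hd : d ∈ Finsupp.supported (ZMod 2) (ZMod 2) {τ : Finset V | Disjoint τ e}) :
    joinBoundary e d ∈ Finsupp.supported (ZMod 2) (ZMod 2) {σ : Finset V | ¬ e ⊆ σ} := by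
  refine apply_mem_of_supported _ _ ?_ hd
  intro τ hτ
  rw [joinBoundary_single]
  refine Submodule.sum_mem _ fun u hu => single_mem_supported fun h => ?_
  have := h hu
  simp only [Finset.mem_union, Finset.mem_erase, ne_eq, not_true_eq_false, false_and,
    or_false] at this
  exact Finset.disjoint_right.1 hτ hu this

theorem boundary_mem_supported_disjoint {e : Finset V} {d : Finset V →₀ ZMod 2}
    (hd : d ∈ Finsupp.supported (ZMod 2) (ZMod 2) {τ : Finset V | Disjoint τ e}) :
    boundary V d ∈ Finsupp.supported (ZMod 2) (ZMod 2) {τ : Finset V | Disjoint τ e} := by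
  refine apply_mem_of_supported _ _ ?_ hd
  intro τ hτ
  rw [boundary_single]
  exact Submodule.sum_mem _ fun v _ => single_mem_supported
    (Finset.disjoint_of_subset_left (Finset.erase_subset _ _) hτ)

/-- The exact sequence of a complex `K'` and the subcomplex `K` of faces not containing `e`: the
homology of `K` vanishes in degree `i` if that of `K'` does, and that of the link `L` of `e` does
in degree `i + 1 - |e|`. -/
theorem cycles_le_boundaries_of_link {K K' L : FaceComplex V} {e : Finset V} {i : ℤ}
    (hK : ∀ σ, σ ∈ K ↔ σ ∈ K' ∧ ¬ e ⊆ σ) (hL : ∀ τ, τ ∈ L ↔ Disjoint τ e ∧ τ ∪ e ∈ K')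
    (h' : cycles K' i ≤ boundaries K' i)
    (hlink : -1 ≤ i + 1 - (e.card : ℤ) →
      cycles L (i + 1 - e.card) ≤ boundaries L (i + 1 - e.card)) :
    cycles K i ≤ boundaries K i := by
  rintro z ⟨hz, hz0⟩
  obtain ⟨c, hc, hcz⟩ := h' ⟨chains_mono (fun σ hσ => ((hK σ).1 hσ).1) i hz, hz0⟩
  obtain ⟨c₀, hc₀, c₁, hc₁, rfl⟩ := exists_add_eq_of_superset e hc
  obtain ⟨d, hdef⟩ : ∃ d, d = removeFace e c₁ := ⟨_, rfl⟩
  have hc₁e : c₁ ∈ Finsupp.supported (ZMod 2) (ZMod 2) {σ : Finset V | e ⊆ σ} :=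
    Finsupp.supported_mono Set.inter_subset_right hc₁
  have hJd : joinFace e d = c₁ := hdef ▸ joinFace_removeFace hc₁e
  have hdL : d ∈ chains L (i + 1 - e.card) := by
    rw [hdef]
    refine apply_mem_of_supported _ _ ?_ hc₁
    rintro σ ⟨⟨hσ, hcard⟩, he⟩
    rw [removeFace_single]
    refine single_mem_supported ⟨(hL _).2 ⟨Finset.sdiff_disjoint, ?_⟩, ?_⟩
    · rwa [Finset.sdiff_union_of_subset he]
    · have := Finset.card_sdiff_add_card_eq_card he
      omega
  have disj : ∀ {j : ℤ} {x}, x ∈ chains L j →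
      x ∈ Finsupp.supported (ZMod 2) (ZMod 2) {τ : Finset V | Disjoint τ e} :=
    fun hx => Finsupp.supported_mono (fun τ hτ => ((hL τ).1 hτ.1).1) hx
  have hd := disj hdL
  -- In `z = ∂c₀ + ∂(d * e)`, every term except `∂d * e` lives on faces not containing `e`, while
  -- `∂d * e` lives on faces containing `e`. Hence `∂d * e = 0`, and removing `e` gives `∂d = 0`.
  have hd0 : boundary V d = 0 := by
    have hzs : z ∈ Finsupp.supported (ZMod 2) (ZMod 2) {σ : Finset V | ¬ e ⊆ σ} :=
      Finsupp.supported_mono (fun σ hσ => ((hK σ).1 hσ.1).2) hz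
    have heq : joinFace e (boundary V d) = z - boundary V c₀ - joinBoundary e d := by
      rw [← hcz, map_add, ← hJd, boundary_joinFace hd]
      abel
    have hnot : joinFace e (boundary V d) ∈
        Finsupp.supported (ZMod 2) (ZMod 2) {σ : Finset V | ¬ e ⊆ σ} := by
      rw [heq]
      exact Submodule.sub_mem _ (Submodule.sub_mem _ hzs (boundary_mem_supported_not_superset
        (Finsupp.supported_mono Set.inter_subset_right hc₀)))
        (joinBoundary_mem_supported_not_superset hd)
    have hsup : joinFace e (boundary V d) ∈
        Finsupp.supported (ZMod 2) (ZMod 2) {σ : Finset V | e ⊆ σ} := by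
      refine apply_mem_of_supported (S := Set.univ) _ _ ?_ (by simp)
      intro τ _
      rw [joinFace_single]
      exact single_mem_supported (Finset.subset_union_right : e ⊆ τ ∪ e)
    have hzero : joinFace e (boundary V d) = 0 := by
      have hdis : Disjoint {σ : Finset V | ¬ e ⊆ σ} {σ : Finset V | e ⊆ σ} :=
        Set.disjoint_left.2 fun σ h1 h2 => h1 h2
      exact Submodule.disjoint_def.1 (Finsupp.disjoint_supported_supported hdis) _ hnot hsup
    rw [← removeFace_joinFace (boundary_mem_supported_disjoint hd), hzero, map_zero]
  obtain ⟨d', hd', hdd'⟩ : d ∈ boundaries L (i + 1 - e.card) := by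
    by_cases hi : -1 ≤ i + 1 - (e.card : ℤ)
    · exact hlink hi ⟨hdL, hd0⟩
    -- Below degree `-1` a face would have negative size.
    · have : d = 0 := by
        have hempty : {τ : Finset V | τ ∈ L ∧ (τ.card : ℤ) = i + 1 - e.card + 1} = ∅ := by
          ext τ
          simp only [Set.mem_ofPred_eq, Set.mem_empty_iff_false, iff_false, not_and]
          intro _ _
          omega
        rw [chains, hempty, Finsupp.supported_empty] at hdL
        exact hdL
      rw [this]
      exact Submodule.zero_mem _
  -- With `∂d' = d`, the part `c₁ = d * e` is traded for `d' * ∂e`, which avoids `e`; the two differ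
  -- by `∂(d' * e)`, so the boundary is still `z`.
  refine ⟨c₀ + joinBoundary e d', Submodule.add_mem _ ?_ ?_, ?_⟩
  · exact Finsupp.supported_mono
      (fun σ hσ => (⟨(hK σ).2 ⟨hσ.1.1, hσ.2⟩, hσ.1.2⟩ :
        σ ∈ K ∧ (σ.card : ℤ) = i + 1 + 1)) hc₀
  · refine apply_mem_of_supported _ _ ?_ hd'
    rintro τ ⟨hτ, hcard⟩
    obtain ⟨hdis, hτe⟩ := (hL τ).1 hτ
    rw [joinBoundary_single]
    refine Submodule.sum_mem _ fun u hu => single_mem_supported ⟨(hK _).2 ⟨?_, ?_⟩, ?_⟩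
    · exact K'.lower (Finset.union_subset_union_right (Finset.erase_subset _ _)) hτe
    · intro h
      have := h hu
      simp only [Finset.mem_union, Finset.mem_erase, ne_eq, not_true_eq_false, false_and,
        or_false] at this
      exact Finset.disjoint_right.1 hdis hu this
    · rw [Finset.card_union_of_disjoint
        (Finset.disjoint_of_subset_right (Finset.erase_subset _ _) hdis)]
      have := Finset.card_erase_add_one hu
      omega
  · have h1 := boundary_joinFace (disj hd')
    rw [hdd', hJd] at h1
    have h2 : joinBoundary e d' = boundary V (joinFace e d') + c₁ := by
      rw [h1, add_comm c₁, add_assoc, add_self_eq_zero_of_zmod_two, add_zero]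
    rw [← hcz, h2, map_add, map_add, boundary_boundary, zero_add, map_add]

theorem le_eta {K : FaceComplex V} {n : ℕ∞}
    (h : ∀ k : ℕ, (k : ℕ∞) ≤ n → IsHomConnected K ((k : ℤ) - 2)) : n ≤ eta K :=
  ENat.forall_natCast_le_iff_le.1 fun k hk => le_iSup₂_of_le k (h k hk) le_rfl

end FaceComplex

/-! ### Deletion, contraction and the induction on edges. -/

namespace FinHypergraph

variable {V : Type*}

theorem mem_independenceComplex {H : FinHypergraph V} {σ : Finset V} :
    σ ∈ H.independenceComplex ↔ ∀ e ∈ H.edges, ¬ e ⊆ σ := Iff.rfl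

variable [DecidableEq V] (H : FinHypergraph V)

/-- Deletion of the edge `e`. -/
def delete (e : Finset V) : FinHypergraph V where
  edges := H.edges.erase e
  nonempty_of_mem f hf := H.nonempty_of_mem f (Finset.mem_of_mem_erase hf)

/-- Contraction of the edge `e`: the other edges lose their vertices in `e`, and the vertices of
`e` become singleton edges. -/
def contract (e : Finset V) : FinHypergraph V where
  edges := {f ∈ (H.edges.erase e).image (· \ e) | f.Nonempty} ∪ e.image singleton
  nonempty_of_mem f hf := by
    rcases Finset.mem_union.1 hf with hf | hf
    · exact (Finset.mem_filter.1 hf).2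
    · obtain ⟨v, _, rfl⟩ := Finset.mem_image.1 hf
      exact Finset.singleton_nonempty v

variable {H}

theorem mem_edges_contract {e f : Finset V} :
    f ∈ (H.contract e).edges ↔
      (f.Nonempty ∧ ∃ g ∈ H.edges, g ≠ e ∧ g \ e = f) ∨ ∃ v ∈ e, f = {v} := by
  simp only [contract, Finset.mem_union, Finset.mem_filter, Finset.mem_image, Finset.mem_erase]
  grind

theorem exists_edge_of_mem_contract {e f : Finset V} {v : V} (hf : f ∈ (H.contract e).edges)
    (hvf : v ∈ f) (hve : v ∉ e) : ∃ g ∈ H.edges, g ≠ e ∧ g \ e = f := by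
  rcases mem_edges_contract.1 hf with ⟨_, h⟩ | ⟨u, hu, rfl⟩
  · exact h
  · exact absurd (Finset.mem_singleton.1 hvf ▸ hu) hve

theorem mem_independenceComplex_iff_delete {e : Finset V} (he : e ∈ H.edges) (σ : Finset V) :
    σ ∈ H.independenceComplex ↔ σ ∈ (H.delete e).independenceComplex ∧ ¬ e ⊆ σ := by
  simp only [mem_independenceComplex, delete, Finset.mem_erase]
  grind

/-- The singleton edges keep faces off `e`, so the link can be described without changing `V`.
Minimality ensures that no edge is lost by becoming empty when `e` is removed from it. -/
theorem mem_independenceComplex_contract {e : Finset V}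
    (hmin : ∀ f ∈ H.edges, f ⊆ e → f = e) (τ : Finset V) :
    τ ∈ (H.contract e).independenceComplex ↔
      Disjoint τ e ∧ τ ∪ e ∈ (H.delete e).independenceComplex := by
  simp only [mem_independenceComplex, delete, Finset.mem_erase, mem_edges_contract]
  constructor
  · intro h
    refine ⟨Finset.disjoint_left.2 fun v hvτ hve => ?_, ?_⟩
    · exact h {v} (Or.inr ⟨v, hve, rfl⟩) (Finset.singleton_subset_iff.2 hvτ)
    · rintro f ⟨hne, hf⟩ hsub
      refine h (f \ e) (Or.inl ⟨?_, f, hf, hne, rfl⟩) ?_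
      · rw [Finset.sdiff_nonempty]
        exact fun hfe => hne (hmin f hf hfe)
      · rw [sdiff_le_iff, sup_comm]
        exact hsub
  · rintro ⟨hdis, h⟩ f (⟨_, g, hg, hge, rfl⟩ | ⟨v, hv, rfl⟩) hsub
    · rw [sdiff_le_iff, sup_comm] at hsub
      exact h g ⟨hge, hg⟩ hsub
    · exact Finset.disjoint_right.1 hdis hv (Finset.singleton_subset_iff.1 hsub)

theorem isHomConnected_of_isolated {v : V} (hv : ∀ e ∈ H.edges, v ∉ e) (k : ℤ) :
    FaceComplex.IsHomConnected H.independenceComplex k := by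
  refine FaceComplex.isHomConnected_of_cone (K := H.independenceComplex) (v := v)
    (fun σ hσ e he hsub => ?_) k
  refine hσ e he fun u hu => (Finset.mem_insert.1 (hsub hu)).resolve_left ?_
  rintro rfl
  exact hv e he hu

theorem isHomConnected_of_delete_of_contract {e : Finset V} (he : e ∈ H.edges) {k l : ℕ}
    (hkl : k + 1 ≤ l + e.card)
    (hdel : FaceComplex.IsHomConnected (H.delete e).independenceComplex ((k : ℤ) - 2))
    (hcon : FaceComplex.IsHomConnected (H.contract e).independenceComplex ((l : ℤ) - 2)) :
    FaceComplex.IsHomConnected H.independenceComplex ((k : ℤ) - 2) := by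
  by_cases hmin : ∀ f ∈ H.edges, f ⊆ e → f = e
  · rw [FaceComplex.isHomConnected_iff] at hdel hcon ⊢
    intro i hi hik
    exact FaceComplex.cycles_le_boundaries_of_link (mem_independenceComplex_iff_delete he)
      (mem_independenceComplex_contract hmin) (hdel i hi hik)
      fun hi' => hcon _ hi' (by omega)
  -- A smaller edge inside `e` makes `e` redundant: deleting it leaves the complex unchanged.
  · push Not at hmin
    obtain ⟨f, hf, hfe, hne⟩ := hmin
    have : H.independenceComplex = (H.delete e).independenceComplex := by
      ext σ
      refine (mem_independenceComplex_iff_delete he σ).trans (and_iff_left_of_imp fun hσ hsub => ?_)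
      exact hσ f (Finset.mem_erase.2 ⟨hne, hf⟩) (hfe.trans hsub)
    rwa [this]

/-- The edges with at least two vertices. -/
def largeEdges (H : FinHypergraph V) : Finset (Finset V) := {e ∈ H.edges | 2 ≤ e.card}

theorem card_largeEdges_delete_lt {e : Finset V} (he : e ∈ H.edges) (hcard : 2 ≤ e.card) :
    (H.delete e).largeEdges.card < H.largeEdges.card := by
  refine Finset.card_lt_card (Finset.ssubset_iff_of_subset ?_ |>.2 ⟨e, ?_, ?_⟩)
  · exact Finset.filter_subset_filter _ (Finset.erase_subset _ _)
  · exact Finset.mem_filter.2 ⟨he, hcard⟩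
  · simp [largeEdges, delete]

/-- Contraction may increase the number of edges, but the added ones are singletons; this is why
only large edges are counted. -/
theorem card_largeEdges_contract_lt {e : Finset V} (he : e ∈ H.edges) (hcard : 2 ≤ e.card) :
    (H.contract e).largeEdges.card < H.largeEdges.card := by
  refine lt_of_le_of_lt ?_ (card_largeEdges_delete_lt he hcard)
  refine (Finset.card_le_card (t := (H.delete e).largeEdges.image (· \ e)) ?_).trans
    Finset.card_image_le
  intro f hf
  obtain ⟨hf, hfc⟩ := Finset.mem_filter.1 hf
  rcases mem_edges_contract.1 hf with ⟨_, g, hg, hge, rfl⟩ | ⟨v, _, rfl⟩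
  · refine Finset.mem_image.2 ⟨g, Finset.mem_filter.2 ⟨Finset.mem_erase.2 ⟨hge, hg⟩, ?_⟩, rfl⟩
    exact hfc.trans (Finset.card_le_card Finset.sdiff_subset)
  · simp at hfc

/-- A lower bound on the connectivity of independence complexes is proved by exhibiting an isolated
vertex or an edge whose deletion preserves the bound and whose contraction lowers it by less than
the size of the edge. -/
theorem isHomConnected_of_recursion (φ : FinHypergraph V → ℕ → Prop)
    (hφ : ∀ H k, φ H k → k = 0 ∨ (∃ v, ∀ e ∈ H.edges, v ∉ e) ∨
      ∃ e ∈ H.edges, 2 ≤ e.card ∧ φ (H.delete e) k ∧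
        φ (H.contract e) (k - (e.card - 1)))
    (H : FinHypergraph V) (k : ℕ) (h : φ H k) :
    FaceComplex.IsHomConnected H.independenceComplex ((k : ℤ) - 2) := by
  induction hn : H.largeEdges.card using Nat.strong_induction_on generalizing H k with
  | _ n ih =>
    subst hn
    rcases hφ H k h with rfl | ⟨v, hv⟩ | ⟨e, he, hcard, hd, hc⟩
    -- For `k = 0` the range `-1 ≤ i ≤ -2` is empty.
    · intro i hi hi'
      norm_num at hi'
      omega
    · exact isHomConnected_of_isolated hv _
    · exact isHomConnected_of_delete_of_contract he (by omega)
        (ih _ (card_largeEdges_delete_lt he hcard) _ _ hd rfl)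
        (ih _ (card_largeEdges_contract_lt he hcard) _ _ hc rfl)

/-! ### Domination under deletion and contraction, and the three bounds. -/

theorem dominatesVertex_iff {W : Finset V} {v : V} :
    H.DominatesVertex W v ↔ ∃ e ∈ H.edges, v ∈ e ∧ e ⊆ insert v W := by
  constructor
  · rintro ⟨W', hW', he⟩
    refine ⟨_, he, Finset.mem_insert_self _ _, Finset.insert_subset_insert _ ?_⟩
    exact hW'.trans (Finset.erase_subset _ _)
  · rintro ⟨e, he, hv, hsub⟩
    refine ⟨e.erase v, ?_, by rwa [Finset.insert_erase hv]⟩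
    intro u hu
    have := hsub (Finset.mem_of_mem_erase hu)
    have := Finset.ne_of_mem_erase hu
    simp_all

theorem Dominates.of_delete {e W A : Finset V} (h : (H.delete e).Dominates W A) :
    H.Dominates W A := by
  intro v hv
  obtain ⟨W', hW', he⟩ := h v hv
  exact ⟨W', hW', Finset.mem_of_mem_erase he⟩

theorem DominatesVertex.mono {W W' : Finset V} {v : V} (h : H.DominatesVertex W v) (hW : W ⊆ W') :
    H.DominatesVertex W' v := by
  obtain ⟨U, hU, he⟩ := h
  exact ⟨U, hU.trans (Finset.erase_subset_erase _ hW), he⟩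

/-- A set dominating a vertex after contraction of `e` dominates it before, together with `e`. -/
theorem DominatesVertex.of_contract {e W : Finset V} {v : V} (he : e ∈ H.edges)
    (h : (H.contract e).DominatesVertex W v) : H.DominatesVertex (W ∪ e) v := by
  rw [dominatesVertex_iff] at h ⊢
  by_cases hve : v ∈ e
  · exact ⟨e, he, hve, Finset.subset_union_right.trans (Finset.subset_insert _ _)⟩
  · obtain ⟨f, hf, hvf, hsub⟩ := h
    obtain ⟨g, hg, -, rfl⟩ := exists_edge_of_mem_contract hf hvf hve
    refine ⟨g, hg, (Finset.mem_sdiff.1 hvf).1, ?_⟩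
    rw [sdiff_le_iff] at hsub
    refine hsub.trans ?_
    intro u hu
    simp only [Finset.sup_eq_union, Finset.mem_union, Finset.mem_insert] at hu ⊢
    tauto

/-- Otherwise every `{v}` is an edge, and the empty set dominates `v` through it. -/
theorem exists_isolated_or_large_edge [Fintype V] (h : ¬ H.Dominates ∅ Finset.univ) :
    (∃ v, ∀ e ∈ H.edges, v ∉ e) ∨ ∃ e ∈ H.edges, 2 ≤ e.card := by
  by_contra! hcon
  obtain ⟨h1, h2⟩ := hcon
  refine h fun v _ => dominatesVertex_iff.2 ?_
  obtain ⟨e, he, hv⟩ := h1 v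
  refine ⟨e, he, hv, ?_⟩
  have := h2 e he
  intro u hu
  rw [Finset.card_le_one.1 (by omega : e.card ≤ 1) u hu v hv]
  exact Finset.mem_insert_self _ _

theorem isHomConnected_of_two_mul_le_card [Fintype V] {k : ℕ}
    (h : ∀ W, H.Dominates W Finset.univ → 2 * k ≤ W.card + 1) :
    FaceComplex.IsHomConnected H.independenceComplex ((k : ℤ) - 2) := by
  refine isHomConnected_of_recursion
    (fun H k => ∀ W, H.Dominates W Finset.univ → 2 * k ≤ W.card + 1) ?_ H k h
  intro H k h
  by_cases h0 : H.Dominates ∅ Finset.univ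
  · left
    have := h _ h0
    simp only [Finset.card_empty] at this
    omega
  refine Or.inr ((exists_isolated_or_large_edge h0).imp_right ?_)
  rintro ⟨e, he, hcard⟩
  refine ⟨e, he, hcard, fun W hW => h W hW.of_delete, fun W hW => ?_⟩
  -- The dominating set grows by at most `|e|`, and `|e| ≤ 2(|e| - 1)` because `|e| ≥ 2`; this is
  -- the source of the factor `2`.
  have h1 := h (W ∪ e) fun v hv => (hW v hv).of_contract he
  have h2 := Finset.card_union_le W e
  omega

theorem isHomConnected_of_le_card_edges [Fintype V] {k : ℕ}
    (h : ∀ F ⊆ H.edges, H.Dominates (F.biUnion id) Finset.univ → k ≤ F.card) :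
    FaceComplex.IsHomConnected H.independenceComplex ((k : ℤ) - 2) := by
  refine isHomConnected_of_recursion
    (fun H k => ∀ F ⊆ H.edges, H.Dominates (F.biUnion id) Finset.univ → k ≤ F.card) ?_ H k h
  intro H k h
  by_cases h0 : H.Dominates ∅ Finset.univ
  · left
    simpa using h ∅ (Finset.empty_subset _) h0
  refine Or.inr ((exists_isolated_or_large_edge h0).imp_right ?_)
  rintro ⟨e, he, hcard⟩
  refine ⟨e, he, hcard, fun F hF hW => h F (hF.trans (Finset.erase_subset _ _)) hW.of_delete,
    fun F hF hW => ?_⟩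
  have hlift : ∀ f ∈ F, ∃ g ∈ H.edges, f ⊆ g := by
    intro f hf
    rcases mem_edges_contract.1 (hF hf) with ⟨_, g, hg, -, rfl⟩ | ⟨v, hv, rfl⟩
    · exact ⟨g, hg, Finset.sdiff_subset⟩
    · exact ⟨e, he, Finset.singleton_subset_iff.2 hv⟩
  choose! g hg hfg using hlift
  -- Lifting each contracted edge to an edge of `H` and adding `e` costs at most one edge, and `1 ≤
  -- |e| - 1`.
  have h1 := h (insert e (F.image g)) ?_ ?_
  · have h2 := Finset.card_insert_le e (F.image g)
    have h3 := Finset.card_image_le (s := F) (f := g)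
    omega
  · refine Finset.insert_subset he fun x hx => ?_
    obtain ⟨f, hf, rfl⟩ := Finset.mem_image.1 hx
    exact hg f hf
  · intro v hv
    refine ((hW v hv).of_contract he).mono (Finset.union_subset ?_ ?_)
    · refine Finset.biUnion_subset.2 fun f hf => (hfg f hf).trans ?_
      exact Finset.subset_biUnion_of_mem id
        (Finset.mem_insert_of_mem (Finset.mem_image_of_mem g hf))
    · exact Finset.subset_biUnion_of_mem id (Finset.mem_insert_self _ _)

theorem eq_of_card_inter_le_one {f A : Finset V} (h : (f ∩ A).card ≤ 1) {u v : V}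
    (hu : u ∈ f) (huA : u ∈ A) (hv : v ∈ f) (hvA : v ∈ A) : u = v :=
  Finset.card_le_one.1 h u (Finset.mem_inter.2 ⟨hu, huA⟩) v (Finset.mem_inter.2 ⟨hv, hvA⟩)

open Classical in
-- The only vertex of `A` in `e` is `a`, which `e \ {a}` dominates, so the remaining set misses `e`.
-- If it contained some `g \ e` with `b ∈ g \ e`, then `g` would meet `A` only in `b`, so that `g ⊆
-- {b} ∪ (e \ {a})` and `b` would have been dominated already.
theorem StronglyIndependent.contract {A e : Finset V} {a : V} (hA : H.StronglyIndependent A)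
    (he : e ∈ H.edges) (ha : a ∈ A) (hae : a ∈ e) :
    (H.contract e).StronglyIndependent {b ∈ A | ¬ H.DominatesVertex (e.erase a) b} := by
  have hea : ∀ b ∈ e, b ∈ A → b = a := fun b hb hbA =>
    eq_of_card_inter_le_one (hA.2 e he) hb hbA hae ha
  have hdom : H.DominatesVertex (e.erase a) a :=
    dominatesVertex_iff.2 ⟨e, he, hae, by rw [Finset.insert_erase hae]⟩
  have hdis : ∀ b ∈ e, b ∉ ({b ∈ A | ¬ H.DominatesVertex (e.erase a) b} : Finset V) := by
    intro b hb hbA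
    obtain ⟨hbA, hnd⟩ := Finset.mem_filter.1 hbA
    rw [hea b hb hbA] at hnd
    exact hnd hdom
  constructor
  · intro f hf hsub
    rcases mem_edges_contract.1 hf with ⟨⟨b, hb⟩, g, hg, -, rfl⟩ | ⟨v, hv, rfl⟩
    · obtain ⟨hbA, hnd⟩ := Finset.mem_filter.1 (hsub hb)
      obtain ⟨hbg, hbe⟩ := Finset.mem_sdiff.1 hb
      refine hnd (dominatesVertex_iff.2 ⟨g, hg, hbg, fun u hu => ?_⟩)
      by_cases hue : u ∈ e
      · refine Finset.mem_insert_of_mem (Finset.mem_erase.2 ⟨?_, hue⟩)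
        rintro rfl
        exact hbe (eq_of_card_inter_le_one (hA.2 g hg) hbg hbA hu ha ▸ hue)
      · have huA := (Finset.mem_filter.1 (hsub (Finset.mem_sdiff.2 ⟨hu, hue⟩))).1
        rw [eq_of_card_inter_le_one (hA.2 g hg) hu huA hbg hbA]
        exact Finset.mem_insert_self _ _
    · exact hdis v hv (Finset.singleton_subset_iff.1 hsub)
  · intro f hf
    rcases mem_edges_contract.1 hf with ⟨_, g, hg, -, rfl⟩ | ⟨v, hv, rfl⟩
    · exact (Finset.card_le_card (Finset.inter_subset_inter Finset.sdiff_subset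
        (Finset.filter_subset _ _))).trans (hA.2 g hg)
    · exact (Finset.card_le_card Finset.inter_subset_left).trans (Finset.card_singleton v).le

open Classical in
-- Adding `e \ {a}` rather than `e` suffices: an edge through another vertex of `A` cannot contain
-- `a`. This saves the one vertex needed to match the drop `|e| - 1`.
theorem Dominates.of_contract_stronglyIndependent {A e W : Finset V} {a : V}
    (hA : H.StronglyIndependent A) (he : e ∈ H.edges) (ha : a ∈ A) (hae : a ∈ e)
    (hW : (H.contract e).Dominates W {b ∈ A | ¬ H.DominatesVertex (e.erase a) b}) :
    H.Dominates (W ∪ e.erase a) A := by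
  intro b hb
  by_cases hd : H.DominatesVertex (e.erase a) b
  · exact hd.mono Finset.subset_union_right
  have hbe : b ∉ e := by
    intro hbe
    refine hd (dominatesVertex_iff.2 ⟨e, he, hbe, ?_⟩)
    rw [eq_of_card_inter_le_one (hA.2 e he) hbe hb hae ha, Finset.insert_erase hae]
  obtain ⟨f, hf, hbf, hsub⟩ := dominatesVertex_iff.1 (hW b (Finset.mem_filter.2 ⟨hb, hd⟩))
  obtain ⟨g, hg, -, rfl⟩ := exists_edge_of_mem_contract hf hbf hbe
  have hbg := (Finset.mem_sdiff.1 hbf).1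
  refine dominatesVertex_iff.2 ⟨g, hg, hbg, fun u hu => ?_⟩
  by_cases hue : u ∈ e
  · refine Finset.mem_insert_of_mem (Finset.mem_union_right _ (Finset.mem_erase.2 ⟨?_, hue⟩))
    rintro rfl
    exact hbe (eq_of_card_inter_le_one (hA.2 g hg) hbg hb hu ha ▸ hue)
  · exact Finset.insert_subset_insert _ Finset.subset_union_left
      (hsub (Finset.mem_sdiff.2 ⟨hu, hue⟩))

theorem isHomConnected_of_stronglyIndependent {A : Finset V} (hA : H.StronglyIndependent A) {k : ℕ}
    (h : ∀ W, H.Dominates W A → k ≤ W.card) :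
    FaceComplex.IsHomConnected H.independenceComplex ((k : ℤ) - 2) := by
  classical
  refine isHomConnected_of_recursion
    (fun H k => ∃ A, H.StronglyIndependent A ∧ ∀ W, H.Dominates W A → k ≤ W.card) ?_ H k ⟨A, hA, h⟩
  clear! A k
  rintro H k ⟨A, hA, h⟩
  rcases A.eq_empty_or_nonempty with rfl | ⟨a, ha⟩
  · left
    simpa using h ∅ fun v hv => absurd hv (Finset.notMem_empty v)
  right
  by_cases hiso : ∀ e ∈ H.edges, a ∉ e
  · exact Or.inl ⟨a, hiso⟩
  push Not at hiso
  obtain ⟨e, he, hae⟩ := hiso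
  refine Or.inr ⟨e, he, ?_, ⟨A, ⟨?_, ?_⟩, fun W hW => h W hW.of_delete⟩,
    _, hA.contract he ha hae, fun W hW => ?_⟩
  -- Otherwise `e = {a}` would be an edge inside the independent set `A`.
  · by_contra hcard
    refine hA.1 e he fun u hu => ?_
    rwa [Finset.card_le_one.1 (by omega : e.card ≤ 1) u hu a hae]
  · exact fun f hf => hA.1 f (Finset.mem_of_mem_erase hf)
  · exact fun f hf => hA.2 f (Finset.mem_of_mem_erase hf)
  · have h1 := h _ (hW.of_contract_stronglyIndependent hA he ha hae)
    have h2 := Finset.card_union_le W (e.erase a)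
    have h3 := Finset.card_erase_of_mem hae
    omega

/-! ### From extended natural numbers to cardinalities, and the conclusion. -/

theorem card_le_of_le_domNumber {A W : Finset V} {n : ℕ} (h : (n : ℕ∞) ≤ H.domNumber A)
    (hW : H.Dominates W A) : n ≤ W.card := by
  exact_mod_cast h.trans (iInf₂_le W hW)

end FinHypergraph

theorem two_mul_le_of_le_ceilHalf {k m : ℕ} {n : ℕ∞} (h : (k : ℕ∞) ≤ ceilHalf n) (hn : n ≤ m) :
    2 * k ≤ m + 1 := by
  induction n using ENat.recTopCoe with
  | top => simp at hn
  | coe n =>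
    have hnm : n ≤ m := by exact_mod_cast hn
    have hk : k ≤ ⌈(n : ℚ) / 2⌉₊ := by
      simp only [ceilHalf, ENat.recTopCoe_natCast] at h
      exact_mod_cast h
    have hlt := Nat.ceil_lt_add_one (a := (n : ℚ) / 2) (by positivity)
    have hk' : (k : ℚ) ≤ (⌈(n : ℚ) / 2⌉₊ : ℕ) := by exact_mod_cast hk
    have : ((2 * k : ℕ) : ℚ) < ((n + 2 : ℕ) : ℚ) := by
      push_cast
      linarith
    have : 2 * k < n + 2 := by exact_mod_cast this
    omega

theorem mainTheorem3 {V : Type*} [Fintype V] [DecidableEq V] (H : FinHypergraph V) :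
    max (ceilHalf H.totalDomNumber) (max H.siDomNumber H.edgeDomNumber) ≤
      FaceComplex.eta H.independenceComplex := by
  refine max_le ?_ (max_le ?_ ?_)
  · refine FaceComplex.le_eta fun k hk => FinHypergraph.isHomConnected_of_two_mul_le_card ?_
    exact fun W hW => two_mul_le_of_le_ceilHalf hk (iInf₂_le W hW)
  · refine iSup₂_le fun A hA => FaceComplex.le_eta fun k hk => ?_
    exact FinHypergraph.isHomConnected_of_stronglyIndependent hA
      fun W hW => FinHypergraph.card_le_of_le_domNumber hk hW
  · refine FaceComplex.le_eta fun k hk => FinHypergraph.isHomConnected_of_le_card_edges ?_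
    intro F hF hW
    exact_mod_cast hk.trans (iInf₂_le F ⟨hF, hW⟩)
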